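/- Let $n\ge 0$ and $N\ge 1$, and let $K_1,\dots,K_N\subseteq\mathbb R^n$ be convex bodies (compact convex sets with nonempty interior); write $A^\circ$ for the interior of $A$. For a matrix-valued function $g=(g_{ij})\colon\mathbb R^n\to\mathbb C^{N\times N}$ with integrable entries let $\hat g(u)=(\hat g_{ij}(u))_{i,j}$ with $\hat g_{ij}(u)=\int_{\mathbb R^n} g_{ij}(x)e^{-2\pi i u\cdot x}\,dx$, and call $g$ of positive type if $g(x)=g(-x)^*$ for every $x\in\mathbb R^n$ and $$\int_{\mathbb R^n}\int_{\mathbb R^n}\rho(y)^*\,g(x-y)\,\rho(x)\,dx\,dy\ \ge\ 0$$ for every $L^\infty$ function $\rho\colon\mathbb R^n\to\mathbb C^N$ for which this double integral converges absolutely. Let $f=(f_{ij})\colon\mathbb R^n\to\mathbb R^{N\times N}$ be such that each $f_{ij}$ is a Schwartz function, and suppose that (i) $f_{ij}(x)\le 0$ whenever $(x+K_i)^\circ\cap K_j^\circ=\emptyset$; (ii) the matrix $\hat f(0)-\bigl((\operatorname{vol}K_i)^{1/2}(\operatorname{vol}K_j)^{1/2}\bigr)_{i,j=1}^N$ is positive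 semidefinite; (iii) $f$ is of positive type. Let $\mathcal P=\bigcup_{(i,x)\in I}(x+K_i)$ be any packing of translated copies of $K_1,\dots,K_N$, that is, $I\subseteq\{1,\dots,N\}\times\mathbb R^n$ and $(x+K_i)^\circ\cap(y+K_j)^\circ=\emptyset$ for all distinct $(i,x),(j,y)\in I$. Then its upper density satisfies $$\limsup_{r\to\infty}\ \sup_{p\in\mathbb R^n}\frac{\operatorname{vol}(B(p,r)\cap\mathcal P)}{\operatorname{vol}B(p,r)}\ \le\ \max_{1\le i\le N} f_{ii}(0),$$ where $B(p,r)$ is the ball of radius $r$ centered at $p$. In particular, if $\mathcal P$ has density $\Delta$, that is, $\Delta=\lim_{r\to\infty}\operatorname{vol}(B(p,r)\cap\mathcal P)/\operatorname{vol}B(p,r)$ for every $p\in\mathbb R^n$, then $\Delta\le\max_{1\le i\le N} f_{ii}(0)$. -/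

import Mathlib

open MeasureTheory Filter Topology
open scoped ENNReal Pointwise ComplexOrder FourierTransform SchwartzMap Matrix

noncomputable section

/-- A set `P` of pairs `(i, x)`, each standing for the translate `x + K i`, is a packing if
distinct pairs give translates with disjoint interiors. -/
def IsTranslativePacking {n N : ℕ} (K : Fin N → ConvexBody (EuclideanSpace ℝ (Fin n)))
    (P : Set (Fin N × EuclideanSpace ℝ (Fin n))) : Prop :=
  ∀ a ∈ P, ∀ b ∈ P, a ≠ b →
    interior (a.2 +ᵥ (K a.1 : Set (EuclideanSpace ℝ (Fin n)))) ∩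
      interior (b.2 +ᵥ (K b.1 : Set (EuclideanSpace ℝ (Fin n)))) = ∅

/-- The union of the translates `x + K i` over `(i, x) ∈ P`. -/
def packingUnion {n N : ℕ} (K : Fin N → ConvexBody (EuclideanSpace ℝ (Fin n)))
    (P : Set (Fin N × EuclideanSpace ℝ (Fin n))) : Set (EuclideanSpace ℝ (Fin n)) :=
  ⋃ a ∈ P, a.2 +ᵥ (K a.1 : Set (EuclideanSpace ℝ (Fin n)))

/-- The set `S` has density `Δ`: around every point `p`, the fraction of the ball `B(p, r)` that
is covered by `S` tends to `Δ` as `r → ∞`. -/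
def HasDensity {n : ℕ} (S : Set (EuclideanSpace ℝ (Fin n))) (Δ : ℝ) : Prop :=
  ∀ p : EuclideanSpace ℝ (Fin n),
    Tendsto (fun r : ℝ => volume.real (Metric.ball p r ∩ S) / volume.real (Metric.ball p r))
      atTop (𝓝 Δ)

/-- The upper density `limsup_{r → ∞} sup_p vol (B(p, r) ∩ S) / vol B(p, r)`. -/
def upperDensity {n : ℕ} (S : Set (EuclideanSpace ℝ (Fin n))) : ℝ≥0∞ :=
  limsup (fun r : ℝ => ⨆ p : EuclideanSpace ℝ (Fin n),
    volume (Metric.ball p r ∩ S) / volume (Metric.ball p r)) atTop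

/-- The entrywise Fourier transform `∫ g_{ij}(x) e^{-2 π i u ⬝ x} dx`. -/
def matrixFourier {n N : ℕ} (g : EuclideanSpace ℝ (Fin n) → Matrix (Fin N) (Fin N) ℂ)
    (u : EuclideanSpace ℝ (Fin n)) : Matrix (Fin N) (Fin N) ℂ :=
  Matrix.of fun i j => 𝓕 (fun x => g x i j) u

/-- A matrix-valued function is of positive type if `g x = (g (-x))^*` for all `x` and
`∫ ∫ ρ(y)^* g(x - y) ρ(x) dx dy ≥ 0` for every `L^∞` function `ρ` for which this double integral
converges absolutely. The pair of integration variables is `z = (x, y)`. -/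
def IsPositiveType {n N : ℕ}
    (g : EuclideanSpace ℝ (Fin n) → Matrix (Fin N) (Fin N) ℂ) : Prop :=
  (∀ x, g x = (g (-x))ᴴ) ∧
  ∀ ρ : EuclideanSpace ℝ (Fin n) → Fin N → ℂ, MemLp ρ ∞ volume →
    Integrable (fun z : EuclideanSpace ℝ (Fin n) × EuclideanSpace ℝ (Fin n) =>
      star (ρ z.2) ⬝ᵥ (g (z.1 - z.2) *ᵥ ρ z.1)) (volume.prod volume) →
    0 ≤ ∫ z : EuclideanSpace ℝ (Fin n) × EuclideanSpace ℝ (Fin n),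
      star (ρ z.2) ⬝ᵥ (g (z.1 - z.2) *ᵥ ρ z.1) ∂(volume.prod volume)

/-- A real matrix of Schwartz functions, viewed as a complex matrix-valued function. -/
def schwartzMatrix {n N : ℕ} (f : Matrix (Fin N) (Fin N) 𝓢(EuclideanSpace ℝ (Fin n), ℝ))
    (x : EuclideanSpace ℝ (Fin n)) : Matrix (Fin N) (Fin N) ℂ :=
  Matrix.of fun i j => ((f i j x : ℝ) : ℂ)

end

/-! By continuity, positivity against bounded functions extends to point masses together with a
uniform density on a ball. For the translates with reference points in a ball of radius `R`, place
mass `√(vol K i)` at each reference point (reflected, to match signs) and subtract, type by type,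
the same total mass `m i` spread evenly over the ball of radius `R + s`, of volume `V`.

Let `F = ∫ f`, let `S` be the total volume of the bodies and `M = max f i i 0`. Each of the two
cross terms is about `-mᵀFm / V` and the background self-energy is about `mᵀFm / V`, so positivity
gives `mᵀFm ≤ V * energy + error` (`IsPositiveType.sum_integral_div_le`). By (i) only the diagonal
can contribute positively to the energy of the points, which is thus at most `M * S`; by (ii), `mᵀFm
≥ S ^ 2`. The error is at most a small multiple of `S ^ 2`, so cancelling `S` bounds it by nearly `M
* V` (`sum_volume_packing_le`).

The error consists of tails of `f`, small for large `s`, and a shell term, small once `R` is large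
compared with `s`. Hence `R → ∞` is taken before `s → ∞`. All bounds are uniform in the centre `p`.
-/

/-! ### Extending positive type from bounded functions to measures. -/

/-- A function of positive type, tested on a simple function supported on compact sets. -/
theorem IsPositiveType.sum_setIntegral_nonneg {n N : ℕ}
    {f : Matrix (Fin N) (Fin N) 𝓢(EuclideanSpace ℝ (Fin n), ℝ)}
    (hf : IsPositiveType (schwartzMatrix f)) {ι : Type*} [Fintype ι] (k : ι → Fin N) (c : ι → ℝ)
    (D : ι → Set (EuclideanSpace ℝ (Fin n))) (hD : ∀ s, IsCompact (D s)) :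
    0 ≤ ∑ s, ∑ t, c s * c t * ∫ z in D t ×ˢ D s, f (k s) (k t) (z.1 - z.2) := by
  classical
  -- Bounded with compact support, so against the continuous `f` the double integral converges
  -- absolutely.
  set ρ : EuclideanSpace ℝ (Fin n) → Fin N → ℂ :=
    ∑ s, (D s).indicator (fun _ => Pi.single (k s) ((c s : ℝ) : ℂ)) with hρ
  have hρL : MemLp ρ ∞ volume :=
    memLp_finsetSum' _ fun s _ => memLp_indicator_const _ (hD s).measurableSet _
      (Or.inr (hD s).measure_lt_top.ne)
  have hint : ∀ s t, IntegrableOn (fun z : EuclideanSpace ℝ (Fin n) × EuclideanSpace ℝ (Fin n) =>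
      f (k s) (k t) (z.1 - z.2)) (D t ×ˢ D s) (volume.prod volume) := fun s t =>
    ((f (k s) (k t)).continuous.comp (continuous_fst.sub continuous_snd)).continuousOn
      |>.integrableOn_compact ((hD t).prod (hD s))
  have key : (fun z : EuclideanSpace ℝ (Fin n) × EuclideanSpace ℝ (Fin n) =>
      star (ρ z.2) ⬝ᵥ (schwartzMatrix f (z.1 - z.2) *ᵥ ρ z.1)) = fun z =>
      ((∑ s, ∑ t, c s * c t * (D t ×ˢ D s).indicator
        (fun z => f (k s) (k t) (z.1 - z.2)) z : ℝ) : ℂ) := by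
    ext z
    simp only [hρ, Finset.sum_apply, star_sum, sum_dotProduct, Matrix.mulVec_sum, dotProduct_sum]
    rw [Finset.sum_comm]
    push_cast
    refine Finset.sum_congr rfl fun s _ => Finset.sum_congr rfl fun t _ => ?_
    by_cases h1 : z.2 ∈ D s <;> by_cases h2 : z.1 ∈ D t <;>
      simp [h1, h2, schwartzMatrix, mul_assoc, mul_left_comm]
  have hint' : ∀ s t, Integrable (fun z : EuclideanSpace ℝ (Fin n) × EuclideanSpace ℝ (Fin n) =>
      c s * c t * (D t ×ˢ D s).indicator (fun z => f (k s) (k t) (z.1 - z.2)) z)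
      (volume.prod volume) := fun s t =>
    ((hint s t).integrable_indicator
      ((hD t).measurableSet.prod (hD s).measurableSet)).const_mul _
  have h := hf.2 ρ hρL
  rw [key] at h
  have h' := h (integrable_finsetSum _ fun s _ => integrable_finsetSum _ fun t _ => hint' s t).ofReal
  rw [integral_complex_ofReal] at h'
  have h'' := Complex.zero_le_real.1 h'
  rw [integral_finsetSum _ fun s _ => integrable_finsetSum _ fun t _ => hint' s t] at h''
  convert h'' using 2 with s _
  rw [integral_finsetSum _ fun t _ => hint' s t]
  refine Finset.sum_congr rfl fun t _ => ?_
  rw [integral_const_mul, integral_indicator ((hD t).measurableSet.prod (hD s).measurableSet)]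
  rfl

/-- Averages of a continuous function over shrinking closed balls tend to its value at the
centre. -/
theorem Continuous.tendsto_setAverage_closedBall {X : Type*} [MetricSpace X] [ProperSpace X]
    [MeasurableSpace X] [BorelSpace X] {μ : Measure X} [IsFiniteMeasureOnCompacts μ]
    [μ.IsOpenPosMeasure] {G : X → ℝ} (hG : Continuous G) (a : X) :
    Tendsto (fun δ => ⨍ x in Metric.closedBall a δ, G x ∂μ) (𝓝[>] 0) (𝓝 (G a)) := by
  rw [Metric.tendsto_nhds]
  intro ε hε
  obtain ⟨η, hη, h⟩ := Metric.continuousAt_iff.1 hG.continuousAt (ε / 2) (half_pos hε)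
  filter_upwards [Ioo_mem_nhdsGT hη] with δ hδ
  have hmem : (⨍ x in Metric.closedBall a δ, G x ∂μ) ∈ Metric.closedBall (G a) (ε / 2) := by
    refine (convex_closedBall _ _).set_average_mem Metric.isClosed_closedBall
      (Metric.measure_closedBall_pos _ _ hδ.1).ne' measure_closedBall_lt_top.ne ?_
      (hG.continuousOn.integrableOn_compact (isCompact_closedBall _ _))
    filter_upwards [ae_restrict_mem Metric.isClosed_closedBall.measurableSet] with x hx
    exact (h (lt_of_le_of_lt hx hδ.2)).le
  exact lt_of_le_of_lt hmem (half_lt_self hε)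

/-- A function of positive type, tested on a sum of point masses and a multiple of the uniform
measure on a ball. -/
theorem IsPositiveType.sum_point_add_ball_nonneg {n N : ℕ}
    {f : Matrix (Fin N) (Fin N) 𝓢(EuclideanSpace ℝ (Fin n), ℝ)}
    (hf : IsPositiveType (schwartzMatrix f)) {α : Type*} [Fintype α] (k : α → Fin N) (w : α → ℝ)
    (q : α → EuclideanSpace ℝ (Fin n)) (v : Fin N → ℝ) (p : EuclideanSpace ℝ (Fin n)) (L : ℝ) :
    0 ≤ ((∑ s, ∑ t, w s * w t * f (k s) (k t) (q t - q s)) +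
        ∑ s, ∑ j, w s * v j * ∫ x in Metric.closedBall p L, f (k s) j (x - q s)) +
      ((∑ i, ∑ t, v i * w t * ∫ y in Metric.closedBall p L, f i (k t) (q t - y)) +
        ∑ i, ∑ j, v i * v j * ∫ x in Metric.closedBall p L,
          ∫ y in Metric.closedBall p L, f i j (x - y)) := by
  have hB := isCompact_closedBall p L
  have c1 : ∀ i j, Continuous (fun z : EuclideanSpace ℝ (Fin n) × EuclideanSpace ℝ (Fin n) =>
      f i j (z.1 - z.2)) := fun i j =>
    (f i j).continuous.comp (continuous_fst.sub continuous_snd)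
  have c2 : ∀ i j, Continuous (fun y => ∫ x in Metric.closedBall p L, f i j (x - y)) := fun i j =>
    continuous_parametric_integral_of_continuous (f := fun y x => f i j (x - y))
      ((f i j).continuous.comp (continuous_snd.sub continuous_fst)) hB
  have c3 : ∀ i j, Continuous (fun x => ∫ y in Metric.closedBall p L, f i j (x - y)) := fun i j =>
    continuous_parametric_integral_of_continuous (c1 i j) hB
  -- Each point mass is smeared uniformly over a ball of radius `δ`; as `δ → 0` every average tends
  -- to the value at its centre.
  have hlim : Tendsto (fun δ : ℝ =>
      ((∑ s, ∑ t, w s * w t *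
          ⨍ z in Metric.closedBall (q t, q s) δ, f (k s) (k t) (z.1 - z.2)) +
        ∑ s, ∑ j, w s * v j *
          ⨍ y in Metric.closedBall (q s) δ, ∫ x in Metric.closedBall p L, f (k s) j (x - y)) +
      ((∑ i, ∑ t, v i * w t *
          ⨍ x in Metric.closedBall (q t) δ, ∫ y in Metric.closedBall p L, f i (k t) (x - y)) +
        ∑ i, ∑ j, v i * v j * ∫ x in Metric.closedBall p L,
          ∫ y in Metric.closedBall p L, f i j (x - y))) (𝓝[>] 0) (𝓝 _) :=
    ((tendsto_finsetSum _ fun s _ => tendsto_finsetSum _ fun t _ =>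
      ((c1 (k s) (k t)).tendsto_setAverage_closedBall (q t, q s)).const_mul (w s * w t)).add
      (tendsto_finsetSum _ fun s _ => tendsto_finsetSum _ fun j _ =>
        ((c2 (k s) j).tendsto_setAverage_closedBall (q s)).const_mul (w s * v j))).add
    ((tendsto_finsetSum _ fun i _ => tendsto_finsetSum _ fun t _ =>
      ((c3 i (k t)).tendsto_setAverage_closedBall (q t)).const_mul (v i * w t)).add
      tendsto_const_nhds)
  refine ge_of_tendsto hlim ?_
  filter_upwards [self_mem_nhdsWithin] with δ hδ
  have hV : ∀ a : EuclideanSpace ℝ (Fin n), volume.real (Metric.closedBall a δ) =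
      volume.real (Metric.closedBall (0 : EuclideanSpace ℝ (Fin n)) δ) := fun a => by
    simp only [measureReal_def, Measure.addHaar_closedBall_center]
  set V := volume.real (Metric.closedBall (0 : EuclideanSpace ℝ (Fin n)) δ)
  -- The smeared masses and the `N` components of the background form one family of weighted
  -- indicators; the factor `V⁻¹` gives the smeared mass at `q s` total weight `w s`.
  have h := hf.sum_setIntegral_nonneg (ι := α ⊕ Fin N) (Sum.elim k id)
    (Sum.elim (fun s => w s * V⁻¹) v)
    (Sum.elim (fun s => Metric.closedBall (q s) δ) (fun _ => Metric.closedBall p L))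
    (by rintro (s | i) <;> exact isCompact_closedBall _ _)
  simp only [Fintype.sum_sum_type, Sum.elim_inl, Sum.elim_inr, id, Finset.sum_add_distrib] at h
  have hi : ∀ i j a b δ₁ δ₂, IntegrableOn
      (fun z : EuclideanSpace ℝ (Fin n) × EuclideanSpace ℝ (Fin n) => f i j (z.1 - z.2))
      (Metric.closedBall a δ₁ ×ˢ Metric.closedBall b δ₂) (volume.prod volume) := fun i j a b _ _ =>
    (c1 i j).continuousOn.integrableOn_compact
      ((isCompact_closedBall _ _).prod (isCompact_closedBall _ _))
  -- In the sup metric, a ball in the product is the product of two balls of the same radius.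
  have e1 : ∀ s t, (⨍ z in Metric.closedBall (q t, q s) δ, f (k s) (k t) (z.1 - z.2)) =
      V⁻¹ * V⁻¹ * ∫ z in Metric.closedBall (q t) δ ×ˢ Metric.closedBall (q s) δ,
        f (k s) (k t) (z.1 - z.2) := fun s t => by
    rw [setAverage_eq, ← closedBall_prod_same, Measure.volume_eq_prod, measureReal_prod_prod,
      hV, hV, smul_eq_mul, mul_inv]
  have e2 : ∀ s j, (⨍ y in Metric.closedBall (q s) δ, ∫ x in Metric.closedBall p L,
      f (k s) j (x - y)) = V⁻¹ * ∫ z in Metric.closedBall p L ×ˢ Metric.closedBall (q s) δ,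
        f (k s) j (z.1 - z.2) := fun s j => by
    rw [setAverage_eq, hV, smul_eq_mul, Measure.volume_eq_prod, ← setIntegral_prod_swap]
    exact congrArg _ (setIntegral_prod _ (hi (k s) j p (q s) L δ).swap).symm
  have e3 : ∀ i t, (⨍ x in Metric.closedBall (q t) δ, ∫ y in Metric.closedBall p L,
      f i (k t) (x - y)) = V⁻¹ * ∫ z in Metric.closedBall (q t) δ ×ˢ Metric.closedBall p L,
        f i (k t) (z.1 - z.2) := fun i t => by
    rw [setAverage_eq, hV, smul_eq_mul, Measure.volume_eq_prod, setIntegral_prod _ (hi _ _ _ _ _ _)]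
  have e4 : ∀ i j, (∫ x in Metric.closedBall p L, ∫ y in Metric.closedBall p L, f i j (x - y)) =
      ∫ z in Metric.closedBall p L ×ˢ Metric.closedBall p L, f i j (z.1 - z.2) := fun i j => by
    rw [Measure.volume_eq_prod, setIntegral_prod _ (hi _ _ _ _ _ _)]
  simp only [e1, e2, e3, e4]
  simp only [mul_assoc, mul_left_comm, mul_comm] at h ⊢
  linarith
-- Tail estimates for integrals of `f` over balls.
/-- The integral over `‖x‖ ≥ s` of the sum of the absolute values of the entries of `f`. -/
noncomputable def tailIntegral {n N : ℕ} (f : Matrix (Fin N) (Fin N) 𝓢(EuclideanSpace ℝ (Fin n), ℝ)) (s : ℝ) :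
    ℝ :=
  ∫ x in (Metric.ball 0 s)ᶜ, ∑ i, ∑ j, |f i j x|

theorem integrable_sum_abs {n N : ℕ}
    (f : Matrix (Fin N) (Fin N) 𝓢(EuclideanSpace ℝ (Fin n), ℝ)) :
    Integrable (fun x => ∑ i, ∑ j, |f i j x|) :=
  integrable_finsetSum _ fun i _ => integrable_finsetSum _ fun j _ => (f i j).integrable.abs

theorem tailIntegral_nonneg {n N : ℕ}
    (f : Matrix (Fin N) (Fin N) 𝓢(EuclideanSpace ℝ (Fin n), ℝ)) (s : ℝ) :
    0 ≤ tailIntegral f s :=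
  integral_nonneg fun _ => Finset.sum_nonneg fun _ _ => Finset.sum_nonneg fun _ _ => abs_nonneg _

theorem tendsto_tailIntegral {n N : ℕ}
    (f : Matrix (Fin N) (Fin N) 𝓢(EuclideanSpace ℝ (Fin n), ℝ)) :
    Tendsto (tailIntegral f) atTop (𝓝 0) := by
  have h := tendsto_setIntegral_of_antitone (μ := volume)
    (s := fun s : ℝ => (Metric.ball (0 : EuclideanSpace ℝ (Fin n)) s)ᶜ)
    (f := fun x => ∑ i, ∑ j, |f i j x|) (fun s => Metric.isOpen_ball.measurableSet.compl)
    (fun s t hst => Set.compl_subset_compl.2 (Metric.ball_subset_ball hst))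
    ⟨0, (integrable_sum_abs f).integrableOn⟩
  have h0 : (⋂ s : ℝ, (Metric.ball (0 : EuclideanSpace ℝ (Fin n)) s)ᶜ) = ∅ := by
    rw [← Set.compl_iUnion, Set.compl_empty_iff, Set.eq_univ_iff_forall]
    exact fun x => Set.mem_iUnion.2 ⟨‖x‖ + 1, by simp⟩
  rwa [h0, setIntegral_empty] at h

/-- Integrating a translate of `f i j` over a set containing a large ball gives almost the full
integral. -/
theorem abs_setIntegral_sub_integral_le {n N : ℕ}
    (f : Matrix (Fin N) (Fin N) 𝓢(EuclideanSpace ℝ (Fin n), ℝ)) (i j : Fin N)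
    {B : Set (EuclideanSpace ℝ (Fin n))} (hB : MeasurableSet B) (a : EuclideanSpace ℝ (Fin n))
    {s : ℝ} (hs : ∀ x ∉ B, s ≤ ‖x - a‖) :
    |(∫ x in B, f i j (x - a)) - ∫ x, f i j x| ≤ tailIntegral f s := by
  have hi : Integrable (fun x => f i j (x - a)) := (f i j).integrable.comp_sub_right a
  have hS : MeasurableSet (Metric.ball (0 : EuclideanSpace ℝ (Fin n)) s)ᶜ :=
    Metric.isOpen_ball.measurableSet.compl
  rw [← integral_sub_right_eq_self (fun x => f i j x) a, ← integral_add_compl hB hi,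
    sub_add_cancel_left, abs_neg, ← integral_indicator hB.compl, tailIntegral,
    ← integral_indicator hS, ← integral_sub_right_eq_self (Set.indicator (Metric.ball 0 s)ᶜ _) a]
  refine (abs_integral_le_integral_abs).trans (integral_mono_of_nonneg
    (ae_of_all _ fun _ => abs_nonneg _)
    (((integrable_sum_abs f).indicator hS).comp_sub_right a) (ae_of_all _ fun x => ?_))
  have hn : ∀ x, 0 ≤ ∑ i, ∑ j, |f i j x| := fun x =>
    Finset.sum_nonneg fun _ _ => Finset.sum_nonneg fun _ _ => abs_nonneg _
  by_cases hx : x ∈ B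
  · simpa [hx] using Set.indicator_nonneg (fun y _ => hn y) (x - a)
  · have hx' : x - a ∈ (Metric.ball (0 : EuclideanSpace ℝ (Fin n)) s)ᶜ := by
      simpa using hs x hx
    simp only [Set.indicator_of_mem hx', Set.indicator_of_mem (Set.mem_compl hx)]
    exact (Finset.single_le_sum (f := fun j => |f i j (x - a)|) (fun _ _ => abs_nonneg _)
      (Finset.mem_univ j)).trans
      (Finset.single_le_sum (f := fun i => ∑ j, |f i j (x - a)|)
        (fun _ _ => Finset.sum_nonneg fun _ _ => abs_nonneg _) (Finset.mem_univ i))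

theorem IsPositiveType.apply_neg {n N : ℕ}
    {f : Matrix (Fin N) (Fin N) 𝓢(EuclideanSpace ℝ (Fin n), ℝ)}
    (hf : IsPositiveType (schwartzMatrix f)) (i j : Fin N) (x : EuclideanSpace ℝ (Fin n)) :
    f i j (-x) = f j i x := by
  have h := congrFun (congrFun (hf.1 x) j) i
  simpa [schwartzMatrix] using h.symm

theorem IsPositiveType.integral_comm {n N : ℕ}
    {f : Matrix (Fin N) (Fin N) 𝓢(EuclideanSpace ℝ (Fin n), ℝ)}
    (hf : IsPositiveType (schwartzMatrix f)) (i j : Fin N) :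
    ∫ x, f i j x = ∫ x, f j i x := by
  rw [← integral_neg_eq_self]
  simp only [hf.apply_neg]

theorem le_norm_sub_of_notMem_closedBall {E : Type*} [SeminormedAddCommGroup E] {p q x : E}
    {R s : ℝ} (hq : q ∈ Metric.closedBall p R) (hx : x ∉ Metric.closedBall p (R + s)) :
    s ≤ ‖x - q‖ := by
  rw [← dist_eq_norm]
  rw [Metric.mem_closedBall] at hq hx
  linarith [dist_triangle x q p]

/-- For `x` in the inner ball, the inner integral misses only a tail beyond distance `s`. In the
remaining shell the crude bound `tailIntegral f 0` is used: it is the full integral of the absolute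
entries, the ball of radius `0` being empty. -/
theorem IsPositiveType.abs_setIntegral_setIntegral_sub_le {n N : ℕ}
    {f : Matrix (Fin N) (Fin N) 𝓢(EuclideanSpace ℝ (Fin n), ℝ)}
    (hf : IsPositiveType (schwartzMatrix f)) (i j : Fin N) (p : EuclideanSpace ℝ (Fin n))
    {R s : ℝ} (hs : 0 ≤ s) :
    |(∫ x in Metric.closedBall p (R + s), ∫ y in Metric.closedBall p (R + s), f i j (x - y)) -
      volume.real (Metric.closedBall p (R + s)) * ∫ x, f i j x| ≤
    tailIntegral f s * volume.real (Metric.closedBall p (R + s)) +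
      tailIntegral f 0 * (volume.real (Metric.closedBall p (R + s)) -
        volume.real (Metric.closedBall p R)) := by
  set B := Metric.closedBall p (R + s)
  have hB : MeasurableSet B := Metric.isClosed_closedBall.measurableSet
  have hsub : Metric.closedBall p R ⊆ B := Metric.closedBall_subset_closedBall (by linarith)
  have hfin : volume B < ∞ := measure_closedBall_lt_top
  have hc : Continuous (fun x => ∫ y in B, f i j (x - y)) :=
    continuous_parametric_integral_of_continuous (f := fun x y => f i j (x - y))
      ((f i j).continuous.comp (continuous_fst.sub continuous_snd)) (isCompact_closedBall _ _)
  have hbd : ∀ x t, (∀ y ∉ B, t ≤ ‖y - x‖) →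
      ‖(∫ y in B, f i j (x - y)) - ∫ x, f i j x‖ ≤ tailIntegral f t := fun x t h => by
    have := abs_setIntegral_sub_integral_le f j i hB x h
    rw [hf.integral_comm j i] at this
    simp only [← hf.apply_neg i j, neg_sub] at this
    exact this
  have hint : IntegrableOn (fun x => (∫ y in B, f i j (x - y)) - ∫ x, f i j x) B :=
    (hc.sub continuous_const).continuousOn.integrableOn_compact (isCompact_closedBall _ _)
  have e : (∫ x in B, ∫ y in B, f i j (x - y)) - volume.real B * ∫ x, f i j x =
      ∫ x in B, ((∫ y in B, f i j (x - y)) - ∫ x, f i j x) := by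
    rw [integral_sub (hc.continuousOn.integrableOn_compact (isCompact_closedBall _ _))
      (integrableOn_const hfin.ne), setIntegral_const, smul_eq_mul]
  rw [e, ← integral_inter_add_sdiff (Metric.isClosed_closedBall (x := p) (ε := R)).measurableSet
    hint, Set.inter_eq_self_of_subset_right hsub]
  have h1 := norm_setIntegral_le_of_norm_le_const (μ := volume) (s := Metric.closedBall p R)
    (f := fun x => (∫ y in B, f i j (x - y)) - ∫ x, f i j x) (C := tailIntegral f s)
    measure_closedBall_lt_top
    fun x hx => hbd x s fun y hy => le_norm_sub_of_notMem_closedBall hx hy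
  have h2 := norm_setIntegral_le_of_norm_le_const (μ := volume) (s := B \ Metric.closedBall p R)
    (f := fun x => (∫ y in B, f i j (x - y)) - ∫ x, f i j x) (C := tailIntegral f 0)
    (lt_of_le_of_lt (measure_mono Set.sdiff_subset) hfin)
    fun x hx => hbd x 0 fun y hy => norm_nonneg _
  rw [measureReal_sdiff hsub Metric.isClosed_closedBall.measurableSet] at h2
  have h3 : volume.real (Metric.closedBall p R) ≤ volume.real B := measureReal_mono hsub hfin.ne
  refine (abs_add_le _ _).trans (add_le_add (h1.trans ?_) h2)
  exact mul_le_mul_of_nonneg_left h3 (tailIntegral_nonneg f s)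

/-! ### The energy inequality. -/

/-- For points with masses `w` in a ball of radius `R`, the quadratic form of the total masses
against `∫ f`, divided by the volume of the ball of radius `R + s`, is at most the energy of the
points up to boundary terms. -/
theorem IsPositiveType.sum_integral_div_le {n N : ℕ}
    {f : Matrix (Fin N) (Fin N) 𝓢(EuclideanSpace ℝ (Fin n), ℝ)}
    (hf : IsPositiveType (schwartzMatrix f)) {α : Type*} [Fintype α] (k : α → Fin N) (w : α → ℝ)
    (hw : ∀ s, 0 ≤ w s) (q : α → EuclideanSpace ℝ (Fin n)) (m : Fin N → ℝ)
    (hm : ∀ X : Fin N → ℝ, ∑ s, w s * X (k s) = ∑ i, m i * X i)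
    (hm0 : ∀ i, 0 ≤ m i)
    (p : EuclideanSpace ℝ (Fin n)) {R s V V₀ : ℝ} (hs : 0 ≤ s)
    (hq : ∀ a, q a ∈ Metric.closedBall p R)
    (hV : volume.real (Metric.closedBall p (R + s)) = V) (hVpos : 0 < V)
    (hV₀ : volume.real (Metric.closedBall p R) = V₀) :
    (∑ i, ∑ j, m i * m j * ∫ x, f i j x) ≤
      V * ∑ a, ∑ b, w a * w b * f (k a) (k b) (q b - q a) +
        (∑ a, w a) ^ 2 * (3 * tailIntegral f s + tailIntegral f 0 * (1 - V₀ / V)) := by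
  have hVi : 0 ≤ V⁻¹ := (inv_pos.2 hVpos).le
  set ε := tailIntegral f s
  set A := tailIntegral f 0
  set F : Fin N → Fin N → ℝ := fun i j => ∫ x, f i j x
  have hB : MeasurableSet (Metric.closedBall p (R + s)) := Metric.isClosed_closedBall.measurableSet
  -- The background neutralises the points: type `i` has mass `-m i` spread over volume `V`.
  have h := hf.sum_point_add_ball_nonneg k w q (fun i => -(m i * V⁻¹)) p (R + s)
  have hX : ∀ a j, F (k a) j - ε ≤ ∫ x in Metric.closedBall p (R + s), f (k a) j (x - q a) :=
    fun a j => by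
      have := (abs_le.1 (abs_setIntegral_sub_integral_le f (k a) j hB (q a) (s := s)
        fun x hx => le_norm_sub_of_notMem_closedBall (hq a) hx)).1
      simp only [F, ε]
      linarith
  have hY : ∀ i a, F i (k a) - ε ≤ ∫ y in Metric.closedBall p (R + s), f i (k a) (q a - y) :=
    fun i a => by
      have := hX a i
      simp only [F] at this ⊢
      rw [hf.integral_comm i (k a)]
      simpa only [← hf.apply_neg i (k a), neg_sub] using this
  have hZ : ∀ i j, (∫ x in Metric.closedBall p (R + s), ∫ y in Metric.closedBall p (R + s),
      f i j (x - y)) ≤ V * F i j + (ε * V + A * (V - V₀)) := fun i j => by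
    have := (abs_le.1 (hf.abs_setIntegral_setIntegral_sub_le i j p (R := R) hs)).2
    rw [hV, hV₀] at this
    simp only [F, ε, A]
    linarith
  have hW : ∑ a, w a = ∑ i, m i := by simpa using hm fun _ => 1
  have s1 : ∑ a, ∑ j, w a * -(m j * V⁻¹) *
      ∫ x in Metric.closedBall p (R + s), f (k a) j (x - q a) ≤
      -V⁻¹ * ((∑ i, ∑ j, m i * m j * F i j) - (∑ a, w a) ^ 2 * ε) := by
    calc _ ≤ ∑ a, ∑ j, w a * -(m j * V⁻¹) * (F (k a) j - ε) :=
          Finset.sum_le_sum fun a _ => Finset.sum_le_sum fun j _ =>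
            mul_le_mul_of_nonpos_left (hX a j) (mul_nonpos_of_nonneg_of_nonpos (hw a)
              (neg_nonpos.2 (mul_nonneg (hm0 j) hVi)))
      _ = ∑ a, w a * ∑ j, -(m j * V⁻¹) * (F (k a) j - ε) := by
          simp only [Finset.mul_sum, mul_assoc]
      -- `hm` regroups a sum over points by type.
      _ = ∑ i, m i * ∑ j, -(m j * V⁻¹) * (F i j - ε) :=
          hm fun i => ∑ j, -(m j * V⁻¹) * (F i j - ε)
      _ = _ := by
          rw [hW, sq, Finset.sum_mul_sum, Finset.sum_mul, ← Finset.sum_sub_distrib, Finset.mul_sum]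
          refine Finset.sum_congr rfl fun i _ => ?_
          rw [Finset.sum_mul, ← Finset.sum_sub_distrib, Finset.mul_sum, Finset.mul_sum]
          exact Finset.sum_congr rfl fun j _ => by ring
  have s2 : ∑ i, ∑ a, -(m i * V⁻¹) * w a *
      ∫ y in Metric.closedBall p (R + s), f i (k a) (q a - y) ≤
      -V⁻¹ * ((∑ i, ∑ j, m i * m j * F i j) - (∑ a, w a) ^ 2 * ε) := by
    calc _ ≤ ∑ i, ∑ a, -(m i * V⁻¹) * w a * (F i (k a) - ε) :=
          Finset.sum_le_sum fun i _ => Finset.sum_le_sum fun a _ =>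
            mul_le_mul_of_nonpos_left (hY i a) (mul_nonpos_of_nonpos_of_nonneg
              (neg_nonpos.2 (mul_nonneg (hm0 i) hVi)) (hw a))
      _ = ∑ i, -(m i * V⁻¹) * ∑ a, w a * (F i (k a) - ε) := by
          simp only [Finset.mul_sum, mul_assoc]
      _ = ∑ i, -(m i * V⁻¹) * ∑ j, m j * (F i j - ε) :=
          Finset.sum_congr rfl fun i _ => by rw [hm fun j => F i j - ε]
      _ = _ := by
          rw [hW, sq, Finset.sum_mul_sum, Finset.sum_mul, ← Finset.sum_sub_distrib, Finset.mul_sum]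
          refine Finset.sum_congr rfl fun i _ => ?_
          rw [Finset.sum_mul, ← Finset.sum_sub_distrib, Finset.mul_sum, Finset.mul_sum]
          exact Finset.sum_congr rfl fun j _ => by ring
  have s3 : ∑ i, ∑ j, -(m i * V⁻¹) * -(m j * V⁻¹) *
      (∫ x in Metric.closedBall p (R + s), ∫ y in Metric.closedBall p (R + s), f i j (x - y)) ≤
      V⁻¹ * ((∑ i, ∑ j, m i * m j * F i j) + (∑ a, w a) ^ 2 * (ε + A * (1 - V₀ / V))) := by
    calc _ ≤ ∑ i, ∑ j, -(m i * V⁻¹) * -(m j * V⁻¹) * (V * F i j + (ε * V + A * (V - V₀))) :=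
          Finset.sum_le_sum fun i _ => Finset.sum_le_sum fun j _ =>
            mul_le_mul_of_nonneg_left (hZ i j) (mul_nonneg_of_nonpos_of_nonpos
              (neg_nonpos.2 (mul_nonneg (hm0 i) hVi)) (neg_nonpos.2 (mul_nonneg (hm0 j) hVi)))
      _ = _ := by
          rw [hW, sq, Finset.sum_mul_sum, Finset.sum_mul, ← Finset.sum_add_distrib, Finset.mul_sum]
          refine Finset.sum_congr rfl fun i _ => ?_
          rw [Finset.sum_mul, ← Finset.sum_add_distrib, Finset.mul_sum]
          exact Finset.sum_congr rfl fun j _ => by field_simp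
  -- The two cross terms and the self-energy each cost one `ε`, hence `3 * ε`; the main terms add up
  -- to `-1 - 1 + 1 = -1` times the quadratic form.
  have hfinal : 0 ≤ (∑ a, ∑ b, w a * w b * f (k a) (k b) (q b - q a)) +
      V⁻¹ * (-(∑ i, ∑ j, m i * m j * F i j) +
        (∑ a, w a) ^ 2 * (3 * ε + A * (1 - V₀ / V))) := by
    refine (h.trans (add_le_add (add_le_add le_rfl s1) (add_le_add s2 s3))).trans (le_of_eq ?_)
    ring
  have := mul_nonneg hVpos.le hfinal
  rw [mul_add, mul_inv_cancel_left₀ hVpos.ne'] at this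
  simp only [F] at this ⊢
  linarith

/-! ### Volume bound for finitely many bodies of a packing. -/

/-- Test on a single unit point mass with no background. -/
theorem IsPositiveType.apply_self_zero_nonneg {n N : ℕ}
    {f : Matrix (Fin N) (Fin N) 𝓢(EuclideanSpace ℝ (Fin n), ℝ)}
    (hf : IsPositiveType (schwartzMatrix f)) (i : Fin N) : 0 ≤ f i i 0 := by
  simpa using hf.sum_point_add_ball_nonneg (α := Unit) (fun _ => i) (fun _ => 1) (fun _ => 0) 0 0 0

/-- Translating by `-b` brings a pair of packed bodies into the relative position to which the sign
condition on `f` applies. -/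
theorem interior_vadd_inter_eq_empty_of_sub {E : Type*} [TopologicalSpace E] [AddCommGroup E]
    [ContinuousConstVAdd E E] {a b : E} {S T : Set E}
    (h : interior (a +ᵥ S) ∩ interior (b +ᵥ T) = ∅) :
    interior ((a - b) +ᵥ S) ∩ interior T = ∅ := by
  have e : a +ᵥ S = b +ᵥ ((a - b) +ᵥ S) := by rw [vadd_vadd, add_sub_cancel]
  rwa [e, interior_vadd, interior_vadd b, ← Set.vadd_set_inter, Set.vadd_set_eq_empty] at h

/-- The bodies of a packing with reference points in a ball of radius `R` have total volume at
most `M V / (1 - C)`, where `V` is the volume of the ball of radius `R + s` and `C` collects the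
boundary terms. -/
theorem sum_volume_packing_le {n N : ℕ}
    (K : Fin N → ConvexBody (EuclideanSpace ℝ (Fin n)))
    (f : Matrix (Fin N) (Fin N) 𝓢(EuclideanSpace ℝ (Fin n), ℝ))
    (h1 : ∀ i j, ∀ x : EuclideanSpace ℝ (Fin n),
      interior (x +ᵥ (K i : Set (EuclideanSpace ℝ (Fin n)))) ∩
        interior (K j : Set (EuclideanSpace ℝ (Fin n))) = ∅ → f i j x ≤ 0)
    (h2 : (matrixFourier (schwartzMatrix f) 0 -
      Matrix.of fun i j : Fin N =>
        ((√(volume.real (K i : Set (EuclideanSpace ℝ (Fin n)))) *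
          √(volume.real (K j : Set (EuclideanSpace ℝ (Fin n)))) : ℝ) : ℂ)).PosSemidef)
    (hf : IsPositiveType (schwartzMatrix f))
    {P : Set (Fin N × EuclideanSpace ℝ (Fin n))} (hP : IsTranslativePacking K P)
    {κ M : ℝ}
    (hκ : ∀ i, 1 ≤ κ * √(volume.real (K i : Set (EuclideanSpace ℝ (Fin n)))))
    (hM0 : 0 ≤ M) (hM : ∀ i, f i i 0 ≤ M)
    (T : Finset (Fin N × EuclideanSpace ℝ (Fin n))) (hT : ↑T ⊆ P)
    (p : EuclideanSpace ℝ (Fin n)) {R s V V₀ : ℝ} (hs : 0 ≤ s)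
    (hTp : ∀ a ∈ T, a.2 ∈ Metric.closedBall p R)
    (hV : volume.real (Metric.closedBall (0 : EuclideanSpace ℝ (Fin n)) (R + s)) = V)
    (hVpos : 0 < V)
    (hV₀ : volume.real (Metric.closedBall (0 : EuclideanSpace ℝ (Fin n)) R) = V₀)
    (hC : 0 < 1 - κ ^ 2 * (3 * tailIntegral f s + tailIntegral f 0 * (1 - V₀ / V))) :
    ∑ a ∈ T, volume.real (K a.1 : Set (EuclideanSpace ℝ (Fin n))) ≤
      M * V / (1 - κ ^ 2 * (3 * tailIntegral f s + tailIntegral f 0 * (1 - V₀ / V))) := by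
  classical
  set C := 3 * tailIntegral f s + tailIntegral f 0 * (1 - V₀ / V)
  set W : Fin N → ℝ := fun i => √(volume.real (K i : Set (EuclideanSpace ℝ (Fin n))))
  have hW0 : ∀ i, 0 ≤ W i := fun i => Real.sqrt_nonneg _
  have hW2 : ∀ i, volume.real (K i : Set (EuclideanSpace ℝ (Fin n))) = W i * W i := fun i =>
    (Real.mul_self_sqrt measureReal_nonneg).symm
  have hcenter : ∀ (c : EuclideanSpace ℝ (Fin n)) (r : ℝ), volume.real (Metric.closedBall c r) =
      volume.real (Metric.closedBall (0 : EuclideanSpace ℝ (Fin n)) r) := fun c r => by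
    simp only [measureReal_def, Measure.addHaar_closedBall_center]
  set m : Fin N → ℝ := fun i => ∑ a : T, if a.1.1 = i then W i else 0 with hmdef
  have hm : ∀ X : Fin N → ℝ, ∑ a : T, W a.1.1 * X a.1.1 = ∑ i, m i * X i := fun X => by
    simp only [hmdef, Finset.sum_mul]
    rw [Finset.sum_comm]
    refine Finset.sum_congr rfl fun a _ => ?_
    simp [ite_mul]
  have hm0 : ∀ i, 0 ≤ m i := fun i =>
    Finset.sum_nonneg fun a _ => by split_ifs; exacts [hW0 i, le_rfl]
  -- The energy evaluates `f` at `q b - q a`, while the sign condition concerns `a.2 - b.2`; hence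
  -- the reflected points `-a.2` and centre `-p`.
  have main := hf.sum_integral_div_le (fun a : T => a.1.1) (fun a => W a.1.1) (fun a => hW0 _)
    (fun a => -a.1.2) m hm hm0 (-p) hs
    (fun a => by simpa [dist_neg_neg] using hTp a.1 a.2)
    ((hcenter _ _).trans hV) hVpos ((hcenter _ _).trans hV₀)
  set S := ∑ a ∈ T, volume.real (K a.1 : Set (EuclideanSpace ℝ (Fin n))) with hSdef
  have hS : S = ∑ a : T, W a.1.1 * W a.1.1 := by
    rw [hSdef, ← Finset.sum_coe_sort]
    exact Finset.sum_congr rfl fun a _ => hW2 _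
  have hS0 : 0 ≤ S := Finset.sum_nonneg fun _ _ => measureReal_nonneg
  have henergy : ∑ a : T, ∑ b : T, W a.1.1 * W b.1.1 * f a.1.1 b.1.1 (-b.1.2 - -a.1.2) ≤ M * S := by
    rw [hS, Finset.mul_sum]
    refine Finset.sum_le_sum fun a _ => ?_
    rw [← Finset.add_sum_erase _ _ (Finset.mem_univ a)]
    have hneg : ∑ b ∈ Finset.univ.erase a,
        W a.1.1 * W b.1.1 * f a.1.1 b.1.1 (-b.1.2 - -a.1.2) ≤ 0 := by
      refine Finset.sum_nonpos fun b hb => mul_nonpos_of_nonneg_of_nonpos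
        (mul_nonneg (hW0 _) (hW0 _)) (h1 _ _ _ ?_)
      rw [show -b.1.2 - -a.1.2 = a.1.2 - b.1.2 by abel]
      exact interior_vadd_inter_eq_empty_of_sub (hP a.1 (hT a.2) b.1 (hT b.2)
        fun h => (Finset.ne_of_mem_erase hb) (Subtype.ext h.symm))
    have hdiag : W a.1.1 * W a.1.1 * f a.1.1 a.1.1 (-a.1.2 - -a.1.2) ≤ M * (W a.1.1 * W a.1.1) := by
      rw [sub_self, mul_comm M]
      exact mul_le_mul_of_nonneg_left (hM _) (mul_nonneg (hW0 _) (hW0 _))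
    linarith
  -- Test semidefiniteness on the vector `m`: the subtracted matrix has rank at most one, with
  -- quadratic form `(∑ i, m i * W i) ^ 2`, and regrouping by type shows `∑ i, m i * W i = S`.
  have hpsd : S ^ 2 ≤ ∑ i, ∑ j, m i * m j * ∫ x, f i j x := by
    have h := h2.dotProduct_mulVec_nonneg fun i => (m i : ℂ)
    have hF : ∀ i j, matrixFourier (schwartzMatrix f) 0 i j = ((∫ x, f i j x : ℝ) : ℂ) := by
      intro i j
      simp [matrixFourier, schwartzMatrix, Real.fourier_eq, integral_complex_ofReal]
    have e : star (fun i => (m i : ℂ)) ⬝ᵥ ((matrixFourier (schwartzMatrix f) 0 -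
        Matrix.of fun i j : Fin N => ((W i * W j : ℝ) : ℂ)) *ᵥ fun i => (m i : ℂ)) =
        ((∑ i, ∑ j, m i * (((∫ x, f i j x) - W i * W j) * m j) : ℝ) : ℂ) := by
      simp only [dotProduct, Matrix.mulVec, Pi.star_apply, Complex.star_def, Complex.conj_ofReal,
        Matrix.sub_apply, Matrix.of_apply, hF, Finset.mul_sum]
      push_cast
      rfl
    rw [e] at h
    have h' := Complex.zero_le_real.1 h
    have hSm : S = ∑ i, m i * W i := hS.trans (hm W)
    have e2 : ∑ i, ∑ j, m i * (((∫ x, f i j x) - W i * W j) * m j) =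
        (∑ i, ∑ j, m i * m j * ∫ x, f i j x) - S ^ 2 := by
      rw [hSm, sq, Finset.sum_mul_sum, ← Finset.sum_sub_distrib]
      refine Finset.sum_congr rfl fun i _ => ?_
      rw [← Finset.sum_sub_distrib]
      exact Finset.sum_congr rfl fun j _ => by ring
    linarith
  have hC0 : 0 ≤ C := by
    have hle : V₀ ≤ V := by
      rw [← hV, ← hV₀]
      exact measureReal_mono (Metric.closedBall_subset_closedBall (by linarith))
        measure_closedBall_lt_top.ne
    have : V₀ / V ≤ 1 := (div_le_one hVpos).2 hle
    have a1 := tailIntegral_nonneg f s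
    have a2 := mul_nonneg (tailIntegral_nonneg f 0) (sub_nonneg.2 this)
    simp only [C]
    linarith
  -- Since `1 ≤ κ * W i`, each mass `W i` is at most `κ * W i ^ 2`; this makes the error comparable
  -- with `S ^ 2`.
  have hWS : (∑ a : T, W a.1.1) ^ 2 ≤ κ ^ 2 * S ^ 2 := by
    rw [← mul_pow]
    refine pow_le_pow_left₀ (Finset.sum_nonneg fun _ _ => hW0 _) ?_ 2
    rw [hS, Finset.mul_sum]
    refine Finset.sum_le_sum fun a _ => ?_
    have := mul_le_mul_of_nonneg_right (hκ a.1.1) (hW0 a.1.1)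
    simp only [W] at this ⊢
    linarith
  -- Chain `S ^ 2 ≤ mᵀFm ≤ V * energy + (∑ W) ^ 2 * C ≤ V * M * S + κ ^ 2 * S ^ 2 * C`.
  have hfin : S * S * (1 - κ ^ 2 * C) ≤ S * (M * V) := by
    have b1 := mul_le_mul_of_nonneg_left henergy hVpos.le
    have b2 := mul_le_mul_of_nonneg_right hWS hC0
    have b3 := hpsd.trans main
    nlinarith
  rw [le_div_iff₀ hC]
  rcases hS0.eq_or_lt with h0 | h0
  · rw [← h0, zero_mul]
    exact mul_nonneg hM0 hVpos.le
  · exact le_of_mul_le_mul_left (by linarith) h0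

/-! ### Passage to the upper density. -/

/-- The volume of the part of a packing inside a ball. -/
theorem volume_ball_inter_packingUnion_le {n N : ℕ}
    (K : Fin N → ConvexBody (EuclideanSpace ℝ (Fin n)))
    {P : Set (Fin N × EuclideanSpace ℝ (Fin n))} {c D R X : ℝ} (hc : 0 < c)
    (hcK : ∀ i, c ≤ volume.real (K i : Set (EuclideanSpace ℝ (Fin n))))
    (hD : ∀ i, (K i : Set (EuclideanSpace ℝ (Fin n))) ⊆ Metric.closedBall 0 D)
    (p : EuclideanSpace ℝ (Fin n))
    (hX : ∀ T : Finset (Fin N × EuclideanSpace ℝ (Fin n)), ↑T ⊆ P →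
      (∀ a ∈ T, a.2 ∈ Metric.closedBall p (R + D)) →
      ∑ a ∈ T, volume.real (K a.1 : Set (EuclideanSpace ℝ (Fin n))) ≤ X) :
    volume (Metric.ball p R ∩ packingUnion K P) ≤ ENNReal.ofReal X := by
  -- A body lies within `D` of its reference point, so every translate meeting the ball of radius
  -- `R` has its index in `Q`.
  set Q : Set (Fin N × EuclideanSpace ℝ (Fin n)) := {a ∈ P | a.2 ∈ Metric.closedBall p (R + D)}
  -- Each body has volume at least `c`, so a finite subset of `Q` has at most `X / c` elements.
  have hQ : Q.Finite := by
    by_contra hinf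
    obtain ⟨T, hT, hcard⟩ := Set.Infinite.exists_subset_card_eq hinf (⌊X / c⌋₊ + 1)
    have h := hX T (fun a ha => (hT ha).1) fun a ha => (hT ha).2
    have h' : (T.card : ℝ) * c ≤ X := by
      rw [← nsmul_eq_mul]
      exact (Finset.card_nsmul_le_sum _ _ _ fun a _ => hcK a.1).trans h
    rw [hcard, ← le_div_iff₀ hc] at h'
    push_cast at h'
    linarith [Nat.lt_floor_add_one (X / c)]
  have hsub : Metric.ball p R ∩ packingUnion K P ⊆
      ⋃ a ∈ hQ.toFinset, a.2 +ᵥ (K a.1 : Set (EuclideanSpace ℝ (Fin n))) := by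
    rintro x ⟨hx, hxP⟩
    simp only [packingUnion, Set.mem_iUnion] at hxP
    obtain ⟨a, ha, y, hy, rfl⟩ := hxP
    simp only [Set.mem_iUnion]
    refine ⟨a, hQ.mem_toFinset.2 ⟨ha, ?_⟩, y, hy, rfl⟩
    have hy' := mem_closedBall_zero_iff.1 (hD a.1 hy)
    simp only [Metric.mem_ball, Metric.mem_closedBall, vadd_eq_add]
      at hx ⊢
    have := dist_triangle a.2 (a.2 + y) p
    rw [dist_self_add_right] at this
    linarith
  calc _ ≤ ∑ a ∈ hQ.toFinset, volume (a.2 +ᵥ (K a.1 : Set (EuclideanSpace ℝ (Fin n)))) :=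
        (measure_mono hsub).trans (measure_biUnion_finset_le _ _)
    _ = ∑ a ∈ hQ.toFinset,
        ENNReal.ofReal (volume.real (K a.1 : Set (EuclideanSpace ℝ (Fin n)))) :=
        Finset.sum_congr rfl fun a _ => by
          rw [measure_vadd, ofReal_measureReal (K a.1).isCompact.measure_lt_top.ne]
    _ = ENNReal.ofReal (∑ a ∈ hQ.toFinset,
        volume.real (K a.1 : Set (EuclideanSpace ℝ (Fin n)))) :=
        (ENNReal.ofReal_sum_of_nonneg fun _ _ => measureReal_nonneg).symm
    _ ≤ _ := ENNReal.ofReal_le_ofReal (hX _ (fun a ha => ((hQ.mem_toFinset).1 ha).1)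
        fun a ha => ((hQ.mem_toFinset).1 ha).2)

theorem volume_real_closedBall_eq {n : ℕ} (p : EuclideanSpace ℝ (Fin n)) {r : ℝ} (hr : 0 ≤ r) :
    volume.real (Metric.closedBall p r) =
      r ^ n * volume.real (Metric.ball (0 : EuclideanSpace ℝ (Fin n)) 1) := by
  rw [measureReal_def, Measure.addHaar_closedBall _ _ hr, ENNReal.toReal_mul,
    ENNReal.toReal_ofReal (pow_nonneg hr _), finrank_euclideanSpace_fin, measureReal_def]

theorem tendsto_add_div_add_pow (a b : ℝ) (n : ℕ) :
    Tendsto (fun r : ℝ => (r + a) ^ n / (r + b) ^ n) atTop (𝓝 1) := by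
  have h : Tendsto (fun r : ℝ => 1 + (a - b) / (r + b)) atTop (𝓝 (1 + 0)) :=
    (tendsto_const_nhds.div_atTop (tendsto_atTop_add_const_right _ b tendsto_id)).const_add 1
  have h' := h.pow n
  rw [add_zero, one_pow] at h'
  refine h'.congr' ?_
  filter_upwards [eventually_gt_atTop (-b)] with r hr
  have : r + b ≠ 0 := by linarith
  rw [← div_pow]
  congr 1
  field_simp
  ring

theorem theorem4 {n N : ℕ} (hN : 0 < N)
    (K : Fin N → ConvexBody (EuclideanSpace ℝ (Fin n)))
    (hK : ∀ i, (interior (K i : Set (EuclideanSpace ℝ (Fin n)))).Nonempty)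
    (f : Matrix (Fin N) (Fin N) 𝓢(EuclideanSpace ℝ (Fin n), ℝ))
    (h1 : ∀ i j, ∀ x : EuclideanSpace ℝ (Fin n),
      interior (x +ᵥ (K i : Set (EuclideanSpace ℝ (Fin n)))) ∩
        interior (K j : Set (EuclideanSpace ℝ (Fin n))) = ∅ → f i j x ≤ 0)
    (h2 : (matrixFourier (schwartzMatrix f) 0 -
      Matrix.of fun i j : Fin N =>
        ((√(volume.real (K i : Set (EuclideanSpace ℝ (Fin n)))) *
          √(volume.real (K j : Set (EuclideanSpace ℝ (Fin n)))) : ℝ) : ℂ)).PosSemidef)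
    (h3 : IsPositiveType (schwartzMatrix f))
    (P : Set (Fin N × EuclideanSpace ℝ (Fin n))) (hP : IsTranslativePacking K P) :
    upperDensity (packingUnion K P) ≤ ENNReal.ofReal (⨆ i, f i i 0) ∧
      ∀ Δ : ℝ, HasDensity (packingUnion K P) Δ → Δ ≤ ⨆ i, f i i 0 := by
  have : Nonempty (Fin N) := ⟨⟨0, hN⟩⟩
  set M := ⨆ i, f i i 0
  have hM : ∀ i, f i i 0 ≤ M := fun i =>
    le_ciSup (f := fun i => f i i 0) (Set.finite_range _).bddAbove i
  have hM0 : 0 ≤ M := (h3.apply_self_zero_nonneg ⟨0, hN⟩).trans (hM _)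
  have hKpos : ∀ i, 0 < volume.real (K i : Set (EuclideanSpace ℝ (Fin n))) := fun i =>
    ENNReal.toReal_pos (Measure.measure_pos_of_nonempty_interior _ (hK i)).ne'
      (K i).isCompact.measure_lt_top.ne
  obtain ⟨c, hc, hcK⟩ : ∃ c, 0 < c ∧
      ∀ i, c ≤ volume.real (K i : Set (EuclideanSpace ℝ (Fin n))) := by
    obtain ⟨i, hi⟩ := Finite.exists_min fun i => volume.real (K i : Set (EuclideanSpace ℝ (Fin n)))
    exact ⟨_, hKpos i, hi⟩
  obtain ⟨D, hD⟩ : ∃ D, ∀ i, (K i : Set (EuclideanSpace ℝ (Fin n))) ⊆ Metric.closedBall 0 D := by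
    obtain ⟨D, hD⟩ := (Bornology.isBounded_iUnion.2 fun i =>
      (K i).isCompact.isBounded).subset_closedBall (0 : EuclideanSpace ℝ (Fin n))
    exact ⟨D, fun i => (Set.subset_iUnion _ i).trans hD⟩
  set κ := (√c)⁻¹
  have hκ0 : 0 ≤ κ := inv_nonneg.2 (Real.sqrt_nonneg _)
  have hκ : ∀ i, 1 ≤ κ * √(volume.real (K i : Set (EuclideanSpace ℝ (Fin n)))) := fun i => by
    rw [← inv_mul_cancel₀ (Real.sqrt_pos.2 hc).ne']
    exact mul_le_mul_of_nonneg_left (Real.sqrt_le_sqrt (hcK i)) hκ0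
  set ω := volume.real (Metric.ball (0 : EuclideanSpace ℝ (Fin n)) 1)
  have hω : 0 < ω := ENNReal.toReal_pos (Metric.measure_ball_pos _ _ one_pos).ne'
    measure_ball_lt_top.ne
  -- The finite bound for reference points within `r + D`, divided by the volume of the ball of
  -- radius `r`; the common factor `ω` cancels.
  set Φ : ℝ → ℝ → ℝ := fun s r => M * ((r + (D + s)) ^ n / (r + 0) ^ n) /
    (1 - κ ^ 2 * (3 * tailIntegral f s +
      tailIntegral f 0 * (1 - (r + D) ^ n / (r + (D + s)) ^ n)))
  have hden : ∀ s, Tendsto (fun r : ℝ => 1 - κ ^ 2 * (3 * tailIntegral f s +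
      tailIntegral f 0 * (1 - (r + D) ^ n / (r + (D + s)) ^ n))) atTop
      (𝓝 (1 - κ ^ 2 * (3 * tailIntegral f s + tailIntegral f 0 * (1 - 1)))) := fun s =>
    ((((tendsto_add_div_add_pow _ _ n).const_sub 1).const_mul _).const_add _
      |>.const_mul _).const_sub 1
  have hbound : ∀ s, 0 ≤ s → 0 < 1 - 3 * κ ^ 2 * tailIntegral f s → ∀ᶠ r in atTop,
      ∀ p, volume (Metric.ball p r ∩ packingUnion K P) / volume (Metric.ball p r) ≤
        ENNReal.ofReal (Φ s r) := by
    intro s hs hpos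
    have hev := (hden s).eventually (lt_mem_nhds (a := 0) (by linarith))
    filter_upwards [hev, eventually_gt_atTop 0, eventually_gt_atTop (-D)] with r hr hr0 hrD p
    have hrs : 0 < r + D + s := by linarith
    have hvb : volume (Metric.ball p r) = ENNReal.ofReal (r ^ n * ω) := by
      rw [Measure.addHaar_ball_of_pos _ _ hr0, finrank_euclideanSpace_fin,
        ENNReal.ofReal_mul (pow_nonneg hr0.le _), ofReal_measureReal measure_ball_lt_top.ne]
    have hratio : (r + D) ^ n * ω / ((r + D + s) ^ n * ω) = (r + D) ^ n / (r + (D + s)) ^ n := by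
      rw [mul_div_mul_right _ _ hω.ne', add_assoc]
    have hvol := volume_ball_inter_packingUnion_le K hc hcK hD p fun T hT hTp =>
      sum_volume_packing_le K f h1 h2 h3 hP hκ hM0 hM T hT p hs hTp
        (volume_real_closedBall_eq 0 hrs.le) (mul_pos (pow_pos hrs n) hω)
        (volume_real_closedBall_eq 0 (by linarith)) (by rw [hratio]; exact hr)
    rw [hratio] at hvol
    rw [hvb]
    refine (ENNReal.div_le_div_right hvol _).trans (le_of_eq ?_)
    rw [← ENNReal.ofReal_div_of_pos (mul_pos (pow_pos hr0 n) hω)]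
    congr 1
    simp only [Φ, add_zero, add_assoc]
    have := (pow_pos hr0 n).ne'
    rw [mul_div_assoc, mul_div_assoc, div_right_comm, mul_div_mul_right _ _ hω.ne', mul_div_assoc]
  have hΦ : ∀ s, 0 < 1 - 3 * κ ^ 2 * tailIntegral f s →
      Tendsto (Φ s) atTop (𝓝 (M / (1 - 3 * κ ^ 2 * tailIntegral f s))) := by
    intro s hpos
    have h := ((tendsto_add_div_add_pow (D + s) 0 n).const_mul M).div (hden s) (by
      rw [sub_self, mul_zero, add_zero]
      linarith)
    rwa [sub_self, mul_zero, add_zero, mul_one, ← mul_assoc, mul_comm (κ ^ 2)] at h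
  have hden' : Tendsto (fun s => 1 - 3 * κ ^ 2 * tailIntegral f s) atTop (𝓝 1) := by
    simpa using ((tendsto_tailIntegral f).const_mul (3 * κ ^ 2)).const_sub 1
  -- For fixed `s` the limit superior in `r` is at most `lim Φ s r`, in which the shell term has
  -- vanished; then `s → ∞` removes the tail.
  have hupper : upperDensity (packingUnion K P) ≤ ENNReal.ofReal M := by
    have hlim : Tendsto (fun s => ENNReal.ofReal (M / (1 - 3 * κ ^ 2 * tailIntegral f s))) atTop
        (𝓝 (ENNReal.ofReal M)) := by
      have := (tendsto_const_nhds (x := M)).div hden' one_ne_zero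
      rw [div_one] at this
      exact ENNReal.tendsto_ofReal this
    refine ge_of_tendsto hlim ?_
    filter_upwards [hden'.eventually (lt_mem_nhds one_pos), eventually_ge_atTop 0] with s hpos hs
    rw [← (ENNReal.tendsto_ofReal (hΦ s hpos)).limsup_eq]
    refine limsup_le_limsup ?_
    filter_upwards [hbound s hs hpos] with r hr
    exact iSup_le hr
  refine ⟨hupper, fun Δ hΔ => ?_⟩
  -- The density read off at the centre `0` is at most the upper density, a supremum over all
  -- centres.
  refine (ENNReal.ofReal_le_ofReal_iff hM0).1 (le_trans ?_ hupper)
  rw [← (ENNReal.tendsto_ofReal (hΔ 0)).limsup_eq]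
  refine limsup_le_limsup ?_
  filter_upwards [eventually_gt_atTop 0] with r hr
  refine le_trans (le_of_eq ?_) (le_iSup _ (0 : EuclideanSpace ℝ (Fin n)))
  have hb : 0 < volume.real (Metric.ball (0 : EuclideanSpace ℝ (Fin n)) r) :=
    ENNReal.toReal_pos (Metric.measure_ball_pos _ _ hr).ne' measure_ball_lt_top.ne
  rw [ENNReal.ofReal_div_of_pos hb, ofReal_measureReal measure_ball_lt_top.ne,
    ofReal_measureReal (lt_of_le_of_lt (measure_mono Set.inter_subset_left) measure_ball_lt_top).ne]
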